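/- Let $n\ge 2$ be an integer and let $A,\delta>0$ be real numbers. Let $K\subset\mathbb R^n$ be the simplex with vertices $0,e_1,\dots,e_n$, and let $U'_\delta$ be the interior of the convex hull of the $n+1$ points $(-\delta,\dots,-\delta)$, $(1+L\delta,-\delta,\dots,-\delta)$, $(-\delta,1+L\delta,-\delta,\dots,-\delta)$, $\dots$, $(-\delta,\dots,-\delta,1+L\delta)$, where $L=\max\{3,n\}$. A tropical curve $G$ in an open set $U\subset\mathbb R^n$ is a finite one-dimensional polyhedral complex in $U$, closed in $U$. Its edges are nondegenerate segments that are closed in $U$, two of which meet at most in a common endpoint. Its vertices are the endpoints of edges that lie in $U$ (an edge may have one or both ends outside $U$). Each vertex is an endpoint of at least three edges. Each edge $e$ carries a weight $w_e\in(\mathbb Z^n\setminus 0)/\{\pm1\}$ parallel to $e$, and at every vertex $v$ the balancing condition $\sum_{e\ni v}\widetilde w_e=0$ holds, where $\widetilde w_e$ is the representative of $w_e$ pointing outwards from $v$. The area of $G$ is $\sum_e |e|\cdot|w_e|$, where $|e|$ is the Euclidean length of $e$ and $|w_e|$ the Euclidean norm of its weight. Then there is an integer $N$, depending only on $n$, $A$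 and $\delta$, such that every tropical curve $G$ in $U'_\delta$ of area at most $A$ has at most $N$ vertices in the interior of $K$. Moreover, $N$ can be chosen with $$N\le 2(n-1)^2\bigl(A+n(A/\delta)^2\bigr)^2 .$$ -/

import Mathlib

/-- The real vector underlying an integral vector, in `ℝⁿ` with its Euclidean norm. -/
noncomputable def intVec {n : ℕ} (w : Fin n → ℤ) : EuclideanSpace ℝ (Fin n) :=
  WithLp.toLp 2 (fun i => (w i : ℝ))

/-- The endpoints of an edge `e` that lie on `e`. For a convex subset of a line that is closed
in the open set `U`, these are exactly the endpoints of the segment that lie in `U`. -/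
def edgeEnds {n : ℕ} (e : Set (EuclideanSpace ℝ (Fin n))) : Set (EuclideanSpace ℝ (Fin n)) :=
  Set.extremePoints ℝ e

open Classical in
/-- The edges in the finite family `E` that have `v` as an endpoint. -/
noncomputable def edgesAt {n : ℕ} (E : Finset (Set (EuclideanSpace ℝ (Fin n))))
    (v : EuclideanSpace ℝ (Fin n)) : Finset (Set (EuclideanSpace ℝ (Fin n))) :=
  E.filter (fun e => v ∈ edgeEnds e)

open Classical in
/-- Of the two representatives `w`, `-w` of the weight of the edge `e`, the one that points
outwards from the endpoint `v` of `e`, that is, from `v` into `e`. -/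
noncomputable def outwardRep {n : ℕ} (e : Set (EuclideanSpace ℝ (Fin n))) (w : Fin n → ℤ)
    (v : EuclideanSpace ℝ (Fin n)) : Fin n → ℤ :=
  if ∃ t : ℝ, 0 < t ∧ v + t • intVec w ∈ e then w else -w

/-- A tropical curve in the open subset `U` of `ℝⁿ`: a finite one-dimensional polyhedral complex
in `U`, given by its edges, with weights. An edge is a nondegenerate segment, closed in `U`; an end
of it that does not lie in `U` is not a vertex (the edge is then unbounded). Two different edges
meet at most in a common endpoint. The vertices are the endpoints of the edges that lie in `U`.

The weight of an edge is an element of `(ℤⁿ ∖ 0) / ±1`; `weight e` is any one of its two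
representatives. The curve is the same for either choice: all the conditions, and the area, depend
on `weight e` only up to sign. The values of `weight` outside `edges` play no role. -/
structure TropicalCurve {n : ℕ} (U : Set (EuclideanSpace ℝ (Fin n))) where
  edges : Finset (Set (EuclideanSpace ℝ (Fin n)))
  weight : Set (EuclideanSpace ℝ (Fin n)) → Fin n → ℤ
  edge_subset : ∀ e ∈ edges, e ⊆ U
  edge_closed : ∀ e ∈ edges, closure e ∩ U ⊆ e
  edge_convex : ∀ e ∈ edges, Convex ℝ e
  edge_nontrivial : ∀ e ∈ edges, e.Nontrivial
  weight_ne_zero : ∀ e ∈ edges, weight e ≠ 0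
  weight_parallel : ∀ e ∈ edges, ∀ x ∈ e, ∀ y ∈ e, ∃ c : ℝ, y - x = c • intVec (weight e)
  edge_inter : ∀ e ∈ edges, ∀ f ∈ edges, e ≠ f → e ∩ f ⊆ edgeEnds e ∩ edgeEnds f
  three_valent : ∀ e ∈ edges, ∀ v ∈ edgeEnds e, 3 ≤ (edgesAt edges v).card
  balanced : ∀ e ∈ edges, ∀ v ∈ edgeEnds e,
    ∑ f ∈ edgesAt edges v, outwardRep f (weight f) v = 0

/-- The set of vertices of a tropical curve. -/
def TropicalCurve.vertices {n : ℕ} {U : Set (EuclideanSpace ℝ (Fin n))} (G : TropicalCurve U) :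
    Set (EuclideanSpace ℝ (Fin n)) :=
  {v | ∃ e ∈ G.edges, v ∈ edgeEnds e}

/-- The tropical area: the sum over all edges of the Euclidean length times the norm of the weight
(infinite if some edge has infinite length). -/
noncomputable def TropicalCurve.area {n : ℕ} {U : Set (EuclideanSpace ℝ (Fin n))}
    (G : TropicalCurve U) : ENNReal :=
  ∑ e ∈ G.edges, Metric.ediam e * ENNReal.ofReal ‖intVec (G.weight e)‖

/-- The `n`-simplex with vertices `0, e₁, …, eₙ` in `ℝⁿ`. -/
def simplexK (n : ℕ) : Set (EuclideanSpace ℝ (Fin n)) :=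
  convexHull ℝ (insert 0 (Set.range fun i : Fin n => EuclideanSpace.single i (1 : ℝ)))

/-- The enlarged open simplex: the interior of the convex hull of `(-δ, …, -δ)` and of the `n`
points with one coordinate `1 + max (3, n) δ` and all the others `-δ`. -/
def simplexU (n : ℕ) (δ : ℝ) : Set (EuclideanSpace ℝ (Fin n)) :=
  interior (convexHull ℝ (insert (WithLp.toLp 2 (fun _ : Fin n => -δ))
    (Set.range fun i : Fin n => WithLp.toLp 2
      (fun j : Fin n => if j = i then 1 + ((max 3 n : ℕ) : ℝ) * δ else -δ))))

/-! The vertices are counted by a planar self-intersection number.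

Let g be the distance to K. For t < δ/√n the set {g < t} lies in the open simplex. Since g is
1-Lipschitz, averaging over t yields a level at which the edges with exactly one end in {g < t} have
total weight S ≤ √n A/δ (`exists_level_sum_le`).

Every vertex has two non-parallel edges: otherwise two of its three edges would leave it in the same
direction and overlap. Hence two of its edges stay independent in the projection to some coordinate
plane. Project the edges having an end in {g < t} to that plane, and prolong to rays those that have
only one end there. This is a balanced planar system. Its intersection number with a small generic
translate of itself has only nonnegative terms, and each nondegenerate vertex gives a nearby
crossing of integral multiplicity at least 1 (`exists_coneInd_eq_one`). By translation invariance
(`sum_coneInd_eq`) the number is determined by the rays alone, and is at most S²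
(`card_le_sum_planeDet`, `TropicalCurve.card_le_sq`).

Summing over the n(n-1) ordered pairs of coordinates gives at most n(n-1)S² vertices. As S = 0 or S
≥ 1, this implies the stated bound. -/

/-! ### Plane determinants and cone indicators. -/

/-- The determinant of two plane vectors. -/
def planeDet (x y : ℝ × ℝ) : ℝ := x.1 * y.2 - x.2 * y.1

/-- The indicator of the positive reals. -/
noncomputable def posInd (r : ℝ) : ℝ := if 0 < r then 1 else 0

lemma posInd_nonneg (r : ℝ) : 0 ≤ posInd r := by
  unfold posInd; split_ifs <;> norm_num

lemma posInd_le_one (r : ℝ) : posInd r ≤ 1 := by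
  unfold posInd; split_ifs <;> norm_num

lemma posInd_mono {r s : ℝ} (h : r ≤ s) : posInd r ≤ posInd s := by
  unfold posInd; split_ifs <;> norm_num; linarith

/-- For independent `u`, `v`: the indicator of the open cone spanned by `u` and `v`. -/
noncomputable def coneInd (x u v : ℝ × ℝ) : ℝ :=
  posInd (planeDet x v / planeDet u v) * posInd (planeDet u x / planeDet u v)

lemma coneInd_le_one (x u v : ℝ × ℝ) : coneInd x u v ≤ 1 :=
  mul_le_one₀ (posInd_le_one _) (posInd_nonneg _) (posInd_le_one _)

lemma posInd_of_pos {r : ℝ} (h : 0 < r) : posInd r = 1 := if_pos h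

lemma posInd_of_neg {r : ℝ} (h : r < 0) : posInd r = 0 := if_neg h.not_gt

/-- Exchange of the roles of the two pairs of vectors `x, y` and `u, v` in the cone indicator. -/
lemma coneInd_exchange {x y u v : ℝ × ℝ} (hux : planeDet u x ≠ 0) (hvx : planeDet v x ≠ 0)
    (huy : planeDet u y ≠ 0) (hvy : planeDet v y ≠ 0) (hyx : planeDet y x ≠ 0)
    (huv : planeDet u v ≠ 0) :
    |planeDet u v| * (coneInd x u v - coneInd y u v) =
      SignType.sign (planeDet y x) * planeDet u v * (coneInd u y x - coneInd v y x) := by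
  -- Plücker relation: it excludes the sign patterns of the six determinants for which the two sides
  -- differ. Geometrically, the indicator of the cone changes along the segment from y to x only
  -- where the segment crosses the ray of u or of v.
  have key : planeDet u v * planeDet y x =
      planeDet u y * planeDet v x - planeDet u x * planeDet v y := by
    unfold planeDet; ring
  have anti : ∀ p q : ℝ × ℝ, planeDet p q = - planeDet q p := by
    intro p q; unfold planeDet; ring
  unfold coneInd
  rw [anti x v, anti y v, anti y u]
  generalize planeDet u v = a at *
  generalize planeDet y x = b at *
  generalize planeDet u x = c at *
  generalize planeDet v x = d at *
  generalize planeDet u y = e at *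
  generalize planeDet v y = f at *
  rcases lt_or_gt_of_ne huv with ha | ha <;> rcases lt_or_gt_of_ne hyx with hb | hb <;>
  rcases lt_or_gt_of_ne hux with hc | hc <;> rcases lt_or_gt_of_ne hvx with hd | hd <;>
  rcases lt_or_gt_of_ne huy with he | he <;> rcases lt_or_gt_of_ne hvy with hf | hf <;>
  simp only [posInd, div_pos_iff, neg_pos, Left.neg_neg_iff, ha, hb, hc, hd, he, hf, ha.not_gt,
    hb.not_gt, hc.not_gt, hd.not_gt, he.not_gt, hf.not_gt, abs_of_neg, abs_of_pos, sign_pos,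
    sign_neg, and_true, and_false, or_true, or_false, if_true, if_false,
    SignType.coe_neg, SignType.coe_one] <;>
  first
  | ring1
  | (exfalso; nlinarith)

lemma planeDet_sub_right (x y z : ℝ × ℝ) :
    planeDet x (y - z) = planeDet x y - planeDet x z := by
  simp [planeDet]; ring

lemma planeDet_smul_right (r : ℝ) (x y : ℝ × ℝ) : planeDet x (r • y) = r * planeDet x y := by
  simp [planeDet]; ring

lemma planeDet_neg_left (x y : ℝ × ℝ) : planeDet (-x) y = - planeDet x y := by
  simp [planeDet]; ring

lemma planeDet_neg_right (x y : ℝ × ℝ) : planeDet x (-y) = - planeDet x y := by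
  simp [planeDet]; ring

lemma planeDet_swap (x y : ℝ × ℝ) : planeDet x y = - planeDet y x := by
  unfold planeDet; ring

lemma sum_planeDet_of_sum_smul_eq_zero {M : Type*} {S : Finset M} {r : M → ℝ} {u : M → ℝ × ℝ}
    (h : ∑ m ∈ S, r m • u m = 0) (w : ℝ × ℝ) : ∑ m ∈ S, r m * planeDet (u m) w = 0 := by
  have h1 : ∑ m ∈ S, r m * (u m).1 = 0 := by simpa [Prod.fst_sum] using congrArg Prod.fst h
  have h2 : ∑ m ∈ S, r m * (u m).2 = 0 := by simpa [Prod.snd_sum] using congrArg Prod.snd h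
  calc ∑ m ∈ S, r m * planeDet (u m) w
      = (∑ m ∈ S, r m * (u m).1) * w.2 - (∑ m ∈ S, r m * (u m).2) * w.1 := by
        rw [Finset.sum_mul, Finset.sum_mul, ← Finset.sum_sub_distrib]
        exact Finset.sum_congr rfl fun m _ => by unfold planeDet; ring
    _ = 0 := by rw [h1, h2]; ring

/-! ### Translation invariance of the intersection number. -/

/-- The self-intersection number of a balanced system of signed rays `c • (a + ℝ₊ u)`, computed
after a generic translation by `ε`, depends only on the directions of the rays. -/
lemma sum_coneInd_eq {M : Type*} [Fintype M] {c : M → ℝ} {a u : M → ℝ × ℝ}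
    (hbal : ∀ ψ : ℝ × ℝ → ℝ, ∑ m, (c m * ψ (a m)) • u m = 0) {ε ν : ℝ × ℝ}
    (hε : ∀ m m' k, u k ≠ 0 → planeDet (u k) (a m' - a m - ε) ≠ 0)
    (hν : ∀ k, u k ≠ 0 → planeDet (u k) ν ≠ 0)
    (hνε : ∀ m m', planeDet ν (a m' - a m - ε) ≠ 0) :
    ∑ m, ∑ m', c m * c m' * (|planeDet (u m) (u m')| *
        coneInd (a m' - a m - ε) (u m) (-u m')) =
      ∑ m, ∑ m', c m * c m' * (|planeDet (u m) (u m')| * coneInd ν (u m) (-u m')) := by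
  rw [← sub_eq_zero, ← Finset.sum_sub_distrib]
  simp_rw [← Finset.sum_sub_distrib]
  set σ : M → M → ℝ := fun m m' => SignType.sign (planeDet ν (a m' - a m - ε)) with hσ
  -- Each of the two correction terms involves one of the two rays only through its base point and,
  -- linearly, its direction. Balance at the base points therefore annihilates the sum over that
  -- ray.
  have hterm : ∀ m m',
      c m * c m' * (|planeDet (u m) (u m')| * coneInd (a m' - a m - ε) (u m) (-u m')) -
        c m * c m' * (|planeDet (u m) (u m')| * coneInd ν (u m) (-u m')) =
      c m * ((c m' * (σ m m' * coneInd (u m) ν (a m' - a m - ε))) * planeDet (u m') (u m)) +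
      c m' * ((c m * (σ m m' * coneInd (-u m') ν (a m' - a m - ε))) *
        planeDet (u m) (u m')) := by
    intro m m'
    by_cases h : planeDet (u m) (u m') = 0
    · rw [planeDet_swap (u m') (u m), h]; simp
    · have hu : u m ≠ 0 := by rintro h0; apply h; simp [h0, planeDet]
      have hu' : u m' ≠ 0 := by rintro h0; apply h; simp [h0, planeDet]
      have := coneInd_exchange (x := a m' - a m - ε) (y := ν) (u := u m) (v := -u m')
        (hε m m' m hu) (by rw [planeDet_neg_left]; exact neg_ne_zero.2 (hε m m' m' hu')) (hν m hu)
        (by rw [planeDet_neg_left]; exact neg_ne_zero.2 (hν m' hu')) (hνε m m')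
        (by rw [planeDet_neg_right]; exact neg_ne_zero.2 h)
      rw [planeDet_neg_right, abs_neg] at this
      rw [planeDet_swap (u m') (u m)]
      simp only [hσ]
      linear_combination (c m * c m') * this
  simp_rw [hterm, Finset.sum_add_distrib]
  have h1 : ∀ m, ∑ m', c m * ((c m' * (σ m m' * coneInd (u m) ν (a m' - a m - ε))) *
      planeDet (u m') (u m)) = 0 := by
    intro m
    rw [← Finset.mul_sum]
    have := sum_planeDet_of_sum_smul_eq_zero (hbal fun p =>
      SignType.sign (planeDet ν (p - a m - ε)) * coneInd (u m) ν (p - a m - ε)) (u m)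
    rw [this, mul_zero]
  have h2 : ∀ m', ∑ m, c m' * ((c m * (σ m m' * coneInd (-u m') ν (a m' - a m - ε))) *
      planeDet (u m) (u m')) = 0 := by
    intro m'
    rw [← Finset.mul_sum]
    have := sum_planeDet_of_sum_smul_eq_zero (hbal fun p =>
      SignType.sign (planeDet ν (a m' - p - ε)) * coneInd (-u m') ν (a m' - p - ε)) (u m')
    rw [this, mul_zero]
  rw [Finset.sum_congr rfl fun m _ => h1 m, Finset.sum_comm, Finset.sum_congr rfl fun m _ => h2 m]
  simp

/-- A finite family of nonzero plane vectors has a common transversal direction. -/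
lemma exists_planeDet_ne_zero {I : Type*} [Finite I] (x : I → ℝ × ℝ) :
    ∃ ν : ℝ × ℝ, ∀ i, x i ≠ 0 → planeDet (x i) ν ≠ 0 := by
  have h : ∀ i, ∀ᶠ τ : ℝ in Filter.cofinite, x i ≠ 0 → planeDet (x i) (1, τ) ≠ 0 := by
    intro i
    rw [Filter.eventually_cofinite]
    refine Set.Subsingleton.finite fun s hs t ht => ?_
    simp only [Set.mem_ofPred_eq, Classical.not_imp, not_not, planeDet] at hs ht
    have h1 : (x i).1 ≠ 0 := by
      intro h1
      refine hs.1 (Prod.ext h1 ?_)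
      have := hs.2
      rw [h1] at this
      simpa using this
    apply mul_left_cancel₀ h1
    linarith [hs.2, ht.2]
  obtain ⟨τ, hτ⟩ := (Filter.eventually_all.2 h).exists
  exact ⟨(1, τ), hτ⟩

/-- A balanced spanning configuration of plane vectors meets its translate in any generic
direction. -/
lemma exists_coneInd_eq_one {M : Type*} {S : Finset M} {u : M → ℝ × ℝ}
    (hsum : ∑ m ∈ S, u m = 0) {p q : M} (hp : p ∈ S) (hq : q ∈ S)
    (hpq : planeDet (u p) (u q) ≠ 0) {ε : ℝ × ℝ} (hε : ∀ m ∈ S, u m ≠ 0 → planeDet (u m) ε ≠ 0) :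
    ∃ m ∈ S, ∃ m' ∈ S, planeDet (u m) (u m') ≠ 0 ∧ coneInd ε (u m) (-u m') = 1 := by
  have hne : ∀ m m', planeDet (u m) (u m') ≠ 0 → u m ≠ 0 ∧ u m' ≠ 0 := fun m m' h =>
    ⟨by rintro h0; apply h; simp [h0, planeDet], by rintro h0; apply h; simp [h0, planeDet]⟩
  have hgood : ∀ m ∈ S, ∀ m' ∈ S, planeDet (u m) (u m') ≠ 0 →
      0 < planeDet (u m) ε * planeDet (u m') ε →
      planeDet (u m) ε * planeDet (u m) (u m') < 0 → coneInd ε (u m) (-u m') = 1 := by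
    intro m hm m' hm' h1 h2 h3
    have e1 : planeDet ε (-u m') = planeDet (u m') ε := by
      simp [planeDet]; ring
    unfold coneInd
    rw [e1, planeDet_neg_right, posInd_of_pos, posInd_of_pos, one_mul]
    · rw [div_pos_iff]
      rcases mul_neg_iff.1 h3 with h | h
      · exact Or.inl ⟨h.1, by linarith⟩
      · exact Or.inr ⟨h.1, by linarith⟩
    · rw [div_pos_iff]
      rcases mul_neg_iff.1 h3 with h | h
      · exact Or.inl ⟨by nlinarith, by linarith⟩
      · exact Or.inr ⟨by nlinarith, by linarith⟩
  by_contra hcon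
  push Not at hcon
  -- For independent u, u' on the same side of the line ℝε, one of the two orders puts ε in the open
  -- cone of one vector and the negative of the other. So, under the contrary assumption, all
  -- vectors on one side are parallel.
  have hside : ∀ m ∈ S, ∀ m' ∈ S, 0 < planeDet (u m) ε * planeDet (u m') ε →
      planeDet (u m) (u m') = 0 := by
    intro m hm m' hm' h
    by_contra h0
    have hmε : planeDet (u m) ε ≠ 0 := left_ne_zero_of_mul h.ne'
    rcases lt_or_gt_of_ne (mul_ne_zero hmε h0) with h3 | h3
    · exact hcon m hm m' hm' h0 (hgood m hm m' hm' h0 h h3)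
    · have h0' : planeDet (u m') (u m) ≠ 0 := by rw [planeDet_swap]; exact neg_ne_zero.2 h0
      refine hcon m' hm' m hm h0' (hgood m' hm' m hm h0' (by rwa [mul_comm]) ?_)
      rw [planeDet_swap (u m') (u m)]
      have : 0 < planeDet (u m) ε ^ 2 := by positivity
      by_contra hge
      push Not at hge
      nlinarith [mul_pos h h3, mul_nonneg this.le hge]
  have hpε := hε p hp (hne p q hpq).1
  have hqε := hε q hq (hne p q hpq).2
  have hopp : planeDet (u p) ε * planeDet (u q) ε < 0 := by
    rcases lt_or_gt_of_ne (mul_ne_zero hpε hqε) with h | h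
    · exact h
    · exact absurd (hside p hp q hq h) hpq
  set k := planeDet (u q) ε * planeDet (u q) (u p) with hk
  have hqp : planeDet (u q) (u p) ≠ 0 := by rw [planeDet_swap]; exact neg_ne_zero.2 hpq
  have hlt : planeDet (u q) (u p) * k ≠ 0 := mul_ne_zero hqp (mul_ne_zero hqε hqp)
  have plucker : ∀ m, planeDet (u m) (u q) = 0 →
      planeDet (u m) (u p) * planeDet (u q) ε = planeDet (u m) ε * planeDet (u q) (u p) := by
    intro m h
    have : planeDet (u m) (u p) * planeDet (u q) ε - planeDet (u m) ε * planeDet (u q) (u p) =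
      planeDet (u m) (u q) * planeDet (u p) ε := by unfold planeDet; ring
    rw [h, zero_mul] at this
    linarith
  -- Pair the balancing relation with u p. Vectors on the side of p drop out; those on the side of q
  -- contribute with one common sign, normalised by the extra factors, and q itself contributes
  -- strictly.
  have hle : ∀ m ∈ S, 0 ≤ planeDet (u q) ε * (planeDet (u m) (u p) * k) := by
    intro m hm
    by_cases h0 : u m = 0
    · simp [h0, planeDet]
    have hmε := hε m hm h0
    rcases lt_or_gt_of_ne (mul_ne_zero hmε hqε) with h | h
    · have hmp : planeDet (u m) (u p) = 0 := by
        apply hside m hm p hp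
        have : 0 < planeDet (u q) ε ^ 2 := by positivity
        by_contra hge
        push Not at hge
        nlinarith [mul_pos_of_neg_of_neg hopp h, mul_nonneg this.le (neg_nonneg.2 hge)]
      simp [hmp]
    · have := plucker m (hside m hm q hq h)
      calc (0 : ℝ) ≤ (planeDet (u m) ε * planeDet (u q) ε) * planeDet (u q) (u p) ^ 2 := by
            positivity
        _ = planeDet (u q) ε * ((planeDet (u m) ε * planeDet (u q) (u p)) *
              planeDet (u q) (u p)) := by ring
        _ = _ := by rw [← this, hk]; ring
  have hzero := sum_planeDet_of_sum_smul_eq_zero (S := S) (r := fun _ => 1) (u := u)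
    (by simpa using hsum) (u p)
  have hzero' : ∑ m ∈ S, planeDet (u q) ε * (planeDet (u m) (u p) * k) = 0 := by
    rw [← Finset.mul_sum, ← Finset.sum_mul]
    simp only [one_mul] at hzero
    simp [hzero]
  exact mul_ne_zero hqε hlt ((Finset.sum_eq_zero_iff_of_nonneg hle).1 hzero' q hq)

/-- The quotients are the coordinates of x in the basis u, -u', which translations along u and u'
shift independently. Hence the signed count of the four pairs of rays of two half-edges factors. -/
lemma coneInd_translate {u u' : ℝ × ℝ} (h : planeDet u u' ≠ 0) (x : ℝ × ℝ) (r r' : ℝ) :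
    coneInd (x - r • u + r' • u') u (-u') =
      posInd (planeDet x (-u') / planeDet u (-u') - r) *
        posInd (planeDet u x / planeDet u (-u') - r') := by
  have h' : planeDet u (-u') ≠ 0 := by rw [planeDet_neg_right]; exact neg_ne_zero.2 h
  unfold coneInd
  congr 2
  · rw [eq_sub_iff_add_eq, div_add' _ _ _ h']
    congr 1
    simp [planeDet]; ring
  · rw [eq_sub_iff_add_eq, div_add' _ _ _ h']
    congr 1
    simp [planeDet]; ring

/-! ### Counting the vertices of a planar system of half-edges. -/

open Classical in
/-- The count of vertices of a planar system of half-edges `a + [0, s] u`. A half-edge is either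
closed, with end `a + s u` labelled by a vertex, or open, and is then prolonged to a ray. -/
lemma card_le_sum_planeDet {H V : Type*} [Fintype H] {a u : H → ℝ × ℝ} {s : H → ℝ}
    (hs : ∀ h, 0 < s h) {C : H → Prop} {z : H → V} {q : V → ℝ × ℝ}
    (hz : ∀ h, C h → q (z h) = a h + s h • u h)
    (hcenter : ∀ ψ : ℝ × ℝ → ℝ, ∑ h, ψ (a h) • u h = 0)
    {W : Finset V} (hend : ∀ ψ : V → ℝ, ∑ h with C h, ψ (z h) • u h = 0)
    (hint : ∀ h h', planeDet (u h) (u h') ≠ 0 → 1 ≤ |planeDet (u h) (u h')|)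
    (hW : ∀ v ∈ W, ∃ h h', C h ∧ C h' ∧ z h = v ∧ z h' = v ∧ planeDet (u h) (u h') ≠ 0) :
    (W.card : ℝ) ≤ ∑ h with ¬ C h, ∑ h' with ¬ C h', |planeDet (u h) (u h')| := by
  set c : H → ℝ := fun h => if C h then 1 else 0 with hc
  -- A closed half-edge is the ray from a minus the ray from its end. The flag `true` marks the
  -- subtracted ray, which has coefficient 0 when the half-edge is open.
  set cM : H × Bool → ℝ := fun m => if m.2 then - c m.1 else 1 with hcM
  set aM : H × Bool → ℝ × ℝ := fun m => if m.2 then a m.1 + s m.1 • u m.1 else a m.1 with haM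
  set uM : H × Bool → ℝ × ℝ := fun m => u m.1 with huM
  have hbal : ∀ ψ : ℝ × ℝ → ℝ, ∑ m, (cM m * ψ (aM m)) • uM m = 0 := by
    intro ψ
    rw [Fintype.sum_prod_type]
    have h1 := hcenter ψ
    have h2 := hend (ψ ∘ q)
    rw [Finset.sum_filter] at h2
    simp only [Fintype.sum_bool, hcM, haM, huM, if_true, Bool.false_eq_true, if_false,
      Finset.sum_add_distrib, one_mul, h1, add_zero]
    rw [← neg_eq_zero, ← Finset.sum_neg_distrib, ← h2]
    refine Finset.sum_congr rfl fun h _ => ?_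
    by_cases hC : C h
    · simp [hc, hC, hz h hC]
    · simp [hc, hC]
  obtain ⟨ε, hε⟩ := exists_planeDet_ne_zero u
  have hpair : ∀ v : W, ∃ h h', C h ∧ C h' ∧ z h = v ∧ z h' = v ∧ planeDet (u h) (u h') ≠ 0 ∧
      coneInd ε (u h) (-u h') = 1 := by
    rintro ⟨v, hv⟩
    obtain ⟨h, h', hC, hC', hzv, hzv', hne⟩ := hW v hv
    have hsum : ∑ k with C k ∧ z k = v, u k = 0 := by
      have := hend fun w => if w = v then 1 else 0
      rw [← this, ← Finset.filter_filter, Finset.sum_filter]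
      exact Finset.sum_congr rfl fun k _ => by split_ifs <;> simp
    obtain ⟨k, hk, k', hk', h1, h2⟩ := exists_coneInd_eq_one hsum (p := h) (q := h')
      (by simp [hC, hzv]) (by simp [hC', hzv']) hne (ε := ε) (fun m _ => hε m)
    simp only [Finset.mem_filter, Finset.mem_univ, true_and] at hk hk'
    exact ⟨k, k', hk.1, hk'.1, hk.2, hk'.2, h1, h2⟩
  choose f f' hCf hCf' hzf hzf' hdet hcone using hpair
  have hRnonneg : 0 ≤ ∑ h with ¬ C h, ∑ h' with ¬ C h', |planeDet (u h) (u h')| :=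
    Finset.sum_nonneg fun _ _ => Finset.sum_nonneg fun _ _ => abs_nonneg _
  rcases W.eq_empty_or_nonempty with rfl | ⟨v₀, hv₀⟩
  · simpa using hRnonneg
  -- Genericity of τ with respect to this one nonzero direction makes all displacements nonzero, as
  -- the choice of ν requires.
  obtain ⟨k₀, hk₀⟩ : ∃ k, u k ≠ 0 := by
    refine ⟨f ⟨v₀, hv₀⟩, fun h0 => hdet ⟨v₀, hv₀⟩ ?_⟩
    simp [h0, planeDet]
  have hgen : ∀ᶠ τ in nhdsWithin (0 : ℝ) (Set.Ioi 0), ∀ m m' k, u k ≠ 0 →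
      planeDet (u k) (aM m' - aM m - τ • ε) ≠ 0 := by
    simp only [Filter.eventually_all]
    intro m m' k hk
    have hsub : {τ : ℝ | planeDet (u k) (aM m' - aM m - τ • ε) = 0}.Subsingleton := by
      intro τ hτ τ' hτ'
      simp only [Set.mem_ofPred_eq, planeDet_sub_right, planeDet_smul_right] at hτ hτ'
      exact mul_right_cancel₀ (hε k hk) (by linarith)
    have hcof : ∀ᶠ τ in nhdsWithin (0 : ℝ) (Set.Ioi 0), τ ∉
        {τ : ℝ | planeDet (u k) (aM m' - aM m - τ • ε) = 0} \ {0} := by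
      apply Filter.Eventually.filter_mono nhdsWithin_le_nhds
      exact (hsub.finite.subset Set.sdiff_subset).isClosed.isOpen_compl.mem_nhds (by simp)
    filter_upwards [hcof, self_mem_nhdsWithin] with τ h1 h2 h3
    exact h1 ⟨h3, (ne_of_gt h2 : τ ≠ 0)⟩
  -- The left sides are the distances, in parameter, of the crossing near v from the ends of the two
  -- half-edges. For small τ the crossing stays inside both.
  have hclose : ∀ᶠ τ in nhdsWithin (0 : ℝ) (Set.Ioi 0), ∀ v : W,
      τ * (planeDet ε (-u (f' v)) / planeDet (u (f v)) (-u (f' v))) < s (f v) ∧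
      τ * (planeDet (u (f v)) ε / planeDet (u (f v)) (-u (f' v))) < s (f' v) := by
    rw [Filter.eventually_all]
    intro v
    have hlim : ∀ x r : ℝ, 0 < r → ∀ᶠ τ in nhdsWithin (0 : ℝ) (Set.Ioi 0), τ * x < r := by
      intro x r hr
      have : Filter.Tendsto (fun τ : ℝ => τ * x) (nhdsWithin (0 : ℝ) (Set.Ioi 0)) (nhds 0) := by
        have : Filter.Tendsto (fun τ : ℝ => τ * x) (nhds 0) (nhds (0 * x)) :=
          (continuous_id.mul continuous_const).tendsto 0
        rw [zero_mul] at this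
        exact this.mono_left nhdsWithin_le_nhds
      exact this.eventually_lt_const hr
    exact (hlim _ _ (hs _)).and (hlim _ _ (hs _))
  obtain ⟨τ, ⟨hτgen, hτclose⟩, hτ⟩ :=
    ((hgen.and hclose).and self_mem_nhdsWithin).exists
  replace hτ : 0 < τ := hτ
  obtain ⟨ν, hν⟩ := exists_planeDet_ne_zero
    (fun i : H ⊕ ((H × Bool) × (H × Bool)) => Sum.elim u (fun p => aM p.2 - aM p.1 - τ • ε) i)
  have hνu : ∀ k, u k ≠ 0 → planeDet (u k) ν ≠ 0 := fun k => hν (Sum.inl k)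
  have hνa : ∀ m m', planeDet ν (aM m' - aM m - τ • ε) ≠ 0 := by
    intro m m'
    have h0 : aM m' - aM m - τ • ε ≠ 0 := by
      intro h0
      apply hτgen m m' k₀ hk₀
      simp [h0, planeDet]
    rw [planeDet_swap]
    exact neg_ne_zero.2 (hν (Sum.inr (m, m')) h0)
  have hmain := sum_coneInd_eq hbal (ε := τ • ε) (ν := ν) (fun m m' k => hτgen m m' k.1)
    (fun k => hνu k.1) hνa
  -- The intersection number of the half-edge h, translated by τε, with the half-edge h'.
  set P : H → H → ℝ := fun h h' => ∑ b, ∑ b', cM (h, b) * cM (h', b') *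
    (|planeDet (u h) (u h')| * coneInd (aM (h', b') - aM (h, b) - τ • ε) (u h) (-u h')) with hP
  have hc01 : ∀ h, 0 ≤ c h ∧ c h ≤ 1 := fun h => by simp only [hc]; split_ifs <;> norm_num
  have hPfac : ∀ h h', planeDet (u h) (u h') ≠ 0 →
      P h h' = |planeDet (u h) (u h')| *
      ((posInd (planeDet (a h' - a h - τ • ε) (-u h') / planeDet (u h) (-u h')) -
        c h * posInd (planeDet (a h' - a h - τ • ε) (-u h') / planeDet (u h) (-u h') - s h)) *
      (posInd (planeDet (u h) (a h' - a h - τ • ε) / planeDet (u h) (-u h')) -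
        c h' * posInd (planeDet (u h) (a h' - a h - τ • ε) / planeDet (u h) (-u h') - s h'))) := by
    intro h h' hne
    have ht : ∀ b b', coneInd (aM (h', b') - aM (h, b) - τ • ε) (u h) (-u h') =
        posInd (planeDet (a h' - a h - τ • ε) (-u h') / planeDet (u h) (-u h') -
          if b then s h else 0) *
        posInd (planeDet (u h) (a h' - a h - τ • ε) / planeDet (u h) (-u h') -
          if b' then s h' else 0) := by
      intro b b'
      rw [← coneInd_translate hne]
      congr 1
      cases b <;> cases b' <;> simp [haM] <;> abel
    simp only [hP, ht, Fintype.sum_bool, hcM, if_true, Bool.false_eq_true, if_false, sub_zero]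
    ring
  have hPnonneg : ∀ h h', 0 ≤ P h h' := by
    intro h h'
    by_cases hne : planeDet (u h) (u h') = 0
    · simp [hP, hne]
    · rw [hPfac h h' hne]
      have hfac : ∀ k x, 0 ≤ posInd x - c k * posInd (x - s k) := by
        intro k x
        have h1 := posInd_mono (sub_le_self x (hs k).le)
        have h2 := posInd_nonneg (x - s k)
        nlinarith [hc01 k]
      exact mul_nonneg (abs_nonneg _) (mul_nonneg (hfac _ _) (hfac _ _))
  have hPone : ∀ v, 1 ≤ P (f v) (f' v) := by
    intro v
    have hcv := hcone v
    have hq : a (f v) + s (f v) • u (f v) = a (f' v) + s (f' v) • u (f' v) := by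
      rw [← hz _ (hCf v), ← hz _ (hCf' v), hzf, hzf']
    have hdet' : planeDet (u (f v)) (-u (f' v)) ≠ 0 := by
      rw [planeDet_neg_right]; exact neg_ne_zero.2 (hdet v)
    have hΔ : a (f' v) - a (f v) - τ • ε =
        s (f v) • u (f v) - s (f' v) • u (f' v) - τ • ε := by
      rw [sub_left_inj, sub_eq_sub_iff_add_eq_add, add_comm (s (f v) • _), hq, add_comm]
    obtain ⟨hcl1, hcl2⟩ := hτclose v
    have e1 : planeDet (a (f' v) - a (f v) - τ • ε) (-u (f' v)) /
        planeDet (u (f v)) (-u (f' v)) =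
        s (f v) - τ * (planeDet ε (-u (f' v)) / planeDet (u (f v)) (-u (f' v))) := by
      rw [hΔ]
      field_simp
      simp [planeDet]; ring
    have e2 : planeDet (u (f v)) (a (f' v) - a (f v) - τ • ε) /
        planeDet (u (f v)) (-u (f' v)) =
        s (f' v) - τ * (planeDet (u (f v)) ε / planeDet (u (f v)) (-u (f' v))) := by
      rw [hΔ]
      field_simp
      simp [planeDet]; ring
    have hpos : 0 < planeDet ε (-u (f' v)) / planeDet (u (f v)) (-u (f' v)) ∧
        0 < planeDet (u (f v)) ε / planeDet (u (f v)) (-u (f' v)) := by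
      unfold coneInd posInd at hcv
      constructor
      · by_contra hn
        simp [hn] at hcv
      · by_contra hn
        simp [hn] at hcv
    have p1 := posInd_of_pos (sub_pos.2 hcl1)
    have p2 := posInd_of_pos (sub_pos.2 hcl2)
    have p3 : posInd (s (f v) - τ * (planeDet ε (-u (f' v)) / planeDet (u (f v)) (-u (f' v))) -
        s (f v)) = 0 := posInd_of_neg (by linarith [mul_pos hτ hpos.1])
    have p4 : posInd (s (f' v) - τ * (planeDet (u (f v)) ε / planeDet (u (f v)) (-u (f' v))) -
        s (f' v)) = 0 := posInd_of_neg (by linarith [mul_pos hτ hpos.2])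
    rw [hPfac _ _ (hdet v), e1, e2, p1, p2, p3, p4]
    simpa using hint _ _ (hdet v)
  have hinj : Function.Injective fun v : W => (f v, f' v) := by
    intro v w hvw
    simp only [Prod.mk.injEq] at hvw
    exact Subtype.ext (by rw [← hzf v, ← hzf w, hvw.1])
  calc (W.card : ℝ) = ∑ v : W, (1 : ℝ) := by simp
    _ ≤ ∑ v : W, P (f v) (f' v) := Finset.sum_le_sum fun v _ => hPone v
    _ = ∑ p ∈ Finset.univ.image (fun v : W => (f v, f' v)), P p.1 p.2 := by
        rw [Finset.sum_image fun v _ w _ h => hinj h]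
    _ ≤ ∑ p : H × H, P p.1 p.2 :=
        Finset.sum_le_sum_of_subset_of_nonneg (Finset.subset_univ _) fun p _ _ => hPnonneg _ _
    _ = ∑ m, ∑ m', cM m * cM m' * (|planeDet (uM m) (uM m')| *
          coneInd (aM m' - aM m - τ • ε) (uM m) (-uM m')) := by
        simp only [Fintype.sum_prod_type, hP, huM]
        refine Finset.sum_congr rfl fun h _ => ?_
        rw [Finset.sum_comm]
    _ = ∑ m, ∑ m', cM m * cM m' * (|planeDet (uM m) (uM m')| * coneInd ν (uM m) (-uM m')) := hmain
    -- With displacement ν the base points no longer matter, so the two rays of a closed half-edge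
    -- cancel.
    _ = ∑ h, ∑ h', (1 - c h) * ((1 - c h') *
          (|planeDet (u h) (u h')| * coneInd ν (u h) (-u h'))) := by
        simp only [Fintype.sum_prod_type, huM, Fintype.sum_bool, hcM, if_true, Bool.false_eq_true,
          if_false]
        refine Finset.sum_congr rfl fun h _ => ?_
        rw [← Finset.sum_add_distrib]
        exact Finset.sum_congr rfl fun h' _ => by ring
    _ ≤ ∑ h, ∑ h', (1 - c h) * ((1 - c h') * |planeDet (u h) (u h')|) := by
        refine Finset.sum_le_sum fun h _ => Finset.sum_le_sum fun h' _ => ?_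
        refine mul_le_mul_of_nonneg_left (mul_le_mul_of_nonneg_left ?_ ?_) ?_
        · exact mul_le_of_le_one_right (abs_nonneg _) (coneInd_le_one _ _ _)
        · linarith [hc01 h']
        · linarith [hc01 h]
    _ = ∑ h with ¬ C h, ∑ h' with ¬ C h', |planeDet (u h) (u h')| := by
        rw [Finset.sum_filter]
        refine Finset.sum_congr rfl fun h _ => ?_
        rw [← Finset.mul_sum]
        by_cases hC : C h
        · simp [hc, hC]
        · simp only [hc, hC, if_false, sub_zero, one_mul, not_false_eq_true, if_true,
            Finset.sum_filter]
          refine Finset.sum_congr rfl fun h' _ => ?_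
          by_cases hC' : C h' <;> simp [hC']

/-! ### Edges as parametrised segments. -/

lemma intVec_neg {n : ℕ} (w : Fin n → ℤ) : intVec (-w) = - intVec w := by
  ext i; simp [intVec]

lemma intVec_ne_zero {n : ℕ} {w : Fin n → ℤ} (h : w ≠ 0) : intVec w ≠ 0 := by
  intro h0
  apply h
  ext i
  have := congrArg (fun v : EuclideanSpace ℝ (Fin n) => v i) h0
  simpa [intVec] using this

lemma one_le_norm_intVec {n : ℕ} {w : Fin n → ℤ} (h : w ≠ 0) : 1 ≤ ‖intVec w‖ := by
  obtain ⟨i, hi⟩ := Function.ne_iff.1 h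
  have h1 : (1 : ℝ) ≤ |(w i : ℝ)| := by exact_mod_cast Int.one_le_abs hi
  have h2 := PiLp.norm_apply_le (intVec w) i
  simp only [intVec, Real.norm_eq_abs] at h2 ⊢
  linarith

/-- The segment `x + [0, ℓ] w` is the closure of `e`, and its ends in `U` belong to `e`. -/
structure IsEdgeParam {n : ℕ} (U e : Set (EuclideanSpace ℝ (Fin n))) (w : Fin n → ℤ)
    (x : EuclideanSpace ℝ (Fin n)) (l : ℝ) : Prop where
  pos : 0 < l
  ne_zero : w ≠ 0
  interior_mem : ∀ s, 0 < s → s < l → x + s • intVec w ∈ e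
  exists_eq : ∀ p ∈ e, ∃ s, 0 ≤ s ∧ s ≤ l ∧ p = x + s • intVec w
  left_mem : x ∈ U → x ∈ e
  right_mem : x + l • intVec w ∈ U → x + l • intVec w ∈ e

/-- The parameters of points of e form a bounded interval, whose infimum and supremum give the two
ends. An end in U belongs to e because e is closed in U. -/
lemma exists_isEdgeParam {n : ℕ} {U e : Set (EuclideanSpace ℝ (Fin n))} {w : Fin n → ℤ}
    (hU : Bornology.IsBounded U) (heU : e ⊆ U) (hcl : closure e ∩ U ⊆ e) (hconv : Convex ℝ e)
    (hnt : e.Nontrivial) (hw : w ≠ 0)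
    (hpar : ∀ x ∈ e, ∀ y ∈ e, ∃ c : ℝ, y - x = c • intVec w) :
    ∃ x l, IsEdgeParam U e w x l := by
  obtain ⟨p, hp, q, hq, hpq⟩ := hnt
  set v := intVec w with hv
  have hv0 : v ≠ 0 := intVec_ne_zero hw
  set I : Set ℝ := {s | p + s • v ∈ e} with hI
  have hmem : ∀ z ∈ e, ∃ s ∈ I, z = p + s • v := by
    intro z hz
    obtain ⟨c, hc⟩ := hpar p hp z hz
    have : z = p + c • v := by rw [← hc]; abel
    exact ⟨c, by rw [hI, Set.mem_ofPred_eq, ← this]; exact hz, this⟩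
  have hIconv : Convex ℝ I := by
    intro s hs t ht a b ha hb hab
    have := hconv hs ht ha hb hab
    have e1 : a • (p + s • v) + b • (p + t • v) = p + (a • s + b • t) • v := by
      have : a • p + b • p = p := by rw [← add_smul, hab, one_smul]
      simp only [smul_add, smul_smul, add_smul, smul_eq_mul]
      nth_rw 3 [← this]
      abel
    rw [e1] at this
    exact this
  have h0I : (0 : ℝ) ∈ I := by simpa [hI] using hp
  have hIbdd : Bornology.IsBounded I := by
    obtain ⟨R, hR⟩ := (Metric.isBounded_iff_subset_closedBall p).1 (hU.subset heU)
    rw [Metric.isBounded_iff_subset_closedBall 0]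
    refine ⟨R / ‖v‖, fun s hs => ?_⟩
    have := hR hs
    rw [mem_closedBall_iff_norm, add_sub_cancel_left, norm_smul] at this
    rw [mem_closedBall_iff_norm, sub_zero, le_div_iff₀ (norm_pos_iff.2 hv0)]
    exact this
  have hlo : sInf I ≤ 0 := csInf_le hIbdd.bddBelow h0I
  have hhi : 0 ≤ sSup I := le_csSup hIbdd.bddAbove h0I
  have hlt : sInf I < sSup I := by
    obtain ⟨c, hc, hqc⟩ := hmem q hq
    have hc0 : c ≠ 0 := by rintro rfl; apply hpq; simp [hqc]
    have h1 := csInf_le hIbdd.bddBelow hc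
    have h2 := le_csSup hIbdd.bddAbove hc
    rcases lt_or_gt_of_ne hc0 with h | h <;> linarith
  have hIoo : ∀ s, sInf I < s → s < sSup I → s ∈ I := by
    intro s h1 h2
    obtain ⟨a, ha, has⟩ := exists_lt_of_csInf_lt ⟨0, h0I⟩ h1
    obtain ⟨b, hb, hbs⟩ := exists_lt_of_lt_csSup ⟨0, h0I⟩ h2
    exact hIconv.ordConnected.out ha hb ⟨has.le, hbs.le⟩
  have hclI : ∀ s ∈ closure I, p + s • v ∈ U → p + s • v ∈ e := by
    intro s hs hsU
    refine hcl ⟨?_, hsU⟩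
    have hcont : Continuous fun s : ℝ => p + s • v := by fun_prop
    exact closure_mono (Set.image_subset_iff.2 fun t ht => ht)
      (image_closure_subset_closure_image hcont ⟨s, hs, rfl⟩)
  have hshift : ∀ s, p + sInf I • v + s • v = p + (sInf I + s) • v := by
    intro s; rw [add_smul, add_assoc]
  refine ⟨p + sInf I • v, sSup I - sInf I, sub_pos.2 hlt, hw, ?_, ?_, ?_, ?_⟩
  · intro s h1 h2
    rw [hshift]
    exact hIoo _ (by linarith) (by linarith)
  · intro z hz
    obtain ⟨s, hs, rfl⟩ := hmem z hz
    have h1 := csInf_le hIbdd.bddBelow hs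
    have h2 := le_csSup hIbdd.bddAbove hs
    exact ⟨s - sInf I, by linarith, by linarith, by rw [hshift]; congr 2; ring⟩
  · exact hclI _ (csInf_mem_closure ⟨0, h0I⟩ hIbdd.bddBelow)
  · rw [hshift, add_sub_cancel]
    exact hclI _ (csSup_mem_closure ⟨0, h0I⟩ hIbdd.bddAbove)

namespace IsEdgeParam

variable {n : ℕ} {U e : Set (EuclideanSpace ℝ (Fin n))} {w : Fin n → ℤ}
  {x v : EuclideanSpace ℝ (Fin n)} {l : ℝ}

lemma symm (h : IsEdgeParam U e w x l) : IsEdgeParam U e (-w) (x + l • intVec w) l := by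
  have hs : ∀ s : ℝ, x + l • intVec w + s • intVec (-w) = x + (l - s) • intVec w := by
    intro s; rw [intVec_neg, sub_smul, smul_neg]; abel
  refine ⟨h.pos, neg_ne_zero.2 h.ne_zero, ?_, ?_, h.right_mem, ?_⟩
  · intro s h1 h2
    rw [hs]
    exact h.interior_mem _ (by linarith) (by linarith)
  · intro p hp
    obtain ⟨s, h1, h2, rfl⟩ := h.exists_eq p hp
    exact ⟨l - s, by linarith, by linarith, by rw [hs]; simp⟩
  · rw [hs]
    simpa using h.left_mem

lemma left_ne_right (h : IsEdgeParam U e w x l) : x ≠ x + l • intVec w := by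
  simpa using ⟨h.pos.ne', intVec_ne_zero h.ne_zero⟩

lemma add_smul_inj (h : IsEdgeParam U e w x l) {s t : ℝ}
    (hst : x + s • intVec w = x + t • intVec w) : s = t :=
  smul_left_injective ℝ (intVec_ne_zero h.ne_zero) (add_left_cancel hst)

lemma left_mem_edgeEnds (h : IsEdgeParam U e w x l) (hx : x ∈ e) : x ∈ edgeEnds e := by
  rw [edgeEnds, mem_extremePoints]
  refine ⟨hx, fun p hp q hq hpq => ?_⟩
  obtain ⟨s, hs0, hs1, rfl⟩ := h.exists_eq p hp
  obtain ⟨t, ht0, ht1, rfl⟩ := h.exists_eq q hq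
  obtain ⟨a, b, ha, hb, hab, heq⟩ := hpq
  have e1 : a • (x + s • intVec w) + b • (x + t • intVec w) =
      x + (a * s + b * t) • intVec w := by
    have : a • x + b • x = x := by rw [← add_smul, hab, one_smul]
    simp only [smul_add, smul_smul, add_smul]
    nth_rw 3 [← this]
    abel
  have e2 : a * s + b * t = 0 := h.add_smul_inj (by rw [← e1, heq]; simp)
  have hs : s = 0 := by nlinarith [mul_nonneg ha.le hs0, mul_nonneg hb.le ht0]
  have ht : t = 0 := by nlinarith [mul_nonneg ha.le hs0, mul_nonneg hb.le ht0]
  simp [hs, ht]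

lemma mem_edgeEnds_iff (h : IsEdgeParam U e w x l) :
    v ∈ edgeEnds e ↔ v ∈ e ∧ (v = x ∨ v = x + l • intVec w) := by
  constructor
  · intro hv
    refine ⟨hv.1, ?_⟩
    obtain ⟨s, hs0, hs1, rfl⟩ := h.exists_eq v hv.1
    by_contra hne
    push Not at hne
    have h0 : 0 < s := lt_of_le_of_ne hs0 (by rintro rfl; simp at hne)
    have h1 : s < l := lt_of_le_of_ne hs1 (by rintro rfl; simp at hne)
    have hρ : 0 < min s (l - s) := lt_min h0 (by linarith)
    have hρ1 := min_le_left s (l - s)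
    have hρ2 := min_le_right s (l - s)
    set ρ := min s (l - s) / 2 with hρdef
    have := ((mem_extremePoints.1 hv).2 _ (h.interior_mem (s - ρ) (by linarith) (by linarith)) _
      (h.interior_mem (s + ρ) (by linarith) (by linarith))
      ⟨1 / 2, 1 / 2, by norm_num, by norm_num, by norm_num, by
        module⟩).1
    have := h.add_smul_inj this
    linarith
  · rintro ⟨hv, rfl | rfl⟩
    · exact h.left_mem_edgeEnds hv
    · exact h.symm.left_mem_edgeEnds hv

lemma outwardRep_left (h : IsEdgeParam U e w x l) : outwardRep e w x = w :=
  if_pos ⟨l / 2, half_pos h.pos, h.interior_mem _ (half_pos h.pos) (half_lt_self h.pos)⟩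

lemma outwardRep_right (h : IsEdgeParam U e w x l) :
    outwardRep e w (x + l • intVec w) = -w := by
  refine if_neg ?_
  rintro ⟨t, ht, hmem⟩
  obtain ⟨s, hs0, hs1, heq⟩ := h.exists_eq _ hmem
  rw [add_assoc, ← add_smul] at heq
  have := h.add_smul_inj heq
  linarith

lemma exists_outward (h : IsEdgeParam U e w x l) (hv : v ∈ edgeEnds e) :
    IsEdgeParam U e (outwardRep e w v) v l := by
  rcases (h.mem_edgeEnds_iff.1 hv).2 with rfl | rfl
  · rwa [h.outwardRep_left]
  · rw [h.outwardRep_right]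
    exact h.symm

lemma le_ediam (h : IsEdgeParam U e w x l) :
    ENNReal.ofReal (l * ‖intVec w‖) ≤ Metric.ediam e := by
  have hcont : Continuous fun s : ℝ => x + s • intVec w := by fun_prop
  have hcl : ∀ s ∈ Set.Icc 0 l, x + s • intVec w ∈ closure e := by
    intro s hs
    rw [← closure_Ioo h.pos.ne] at hs
    exact closure_mono (Set.image_subset_iff.2 fun t ht => h.interior_mem t ht.1 ht.2)
      (image_closure_subset_closure_image hcont ⟨s, hs, rfl⟩)
  have h1 := Metric.edist_le_ediam_of_mem (hcl l ⟨h.pos.le, le_rfl⟩) (hcl 0 ⟨le_rfl, h.pos.le⟩)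
  rw [Metric.ediam_closure, edist_dist, dist_eq_norm] at h1
  simpa [norm_smul, abs_of_pos h.pos] using h1

/-- Two edges of a tropical curve that leave a common vertex in the same direction are equal. -/
lemma eq_of_smul_eq {f : Set (EuclideanSpace ℝ (Fin n))} {w' : Fin n → ℤ} {l' : ℝ}
    (h : IsEdgeParam U e w v l) (h' : IsEdgeParam U f w' v l')
    (hef : e ≠ f → e ∩ f ⊆ edgeEnds e ∩ edgeEnds f) {c : ℝ} (hc : 0 < c)
    (hcw : intVec w' = c • intVec w) : e = f := by
  by_contra hne
  have hpos : 0 < min l (c * l') := lt_min h.pos (mul_pos hc h'.pos)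
  have h1 := min_le_left l (c * l')
  have h2 := min_le_right l (c * l')
  set s := min l (c * l') / 2 with hs
  have hse : v + s • intVec w ∈ e := h.interior_mem s (by linarith) (by linarith)
  have hsf : v + s • intVec w ∈ f := by
    have := h'.interior_mem (s / c) (div_pos (by linarith) hc)
      ((div_lt_iff₀ hc).2 (by linarith [mul_comm c l']))
    rwa [hcw, smul_smul, div_mul_cancel₀ _ hc.ne'] at this
  rcases (h.mem_edgeEnds_iff.1 (hef hne ⟨hse, hsf⟩).1).2 with h3 | h3
  · have := h.add_smul_inj (s := s) (t := 0) (by simpa using h3)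
    linarith
  · have := h.add_smul_inj h3
    linarith

end IsEdgeParam

/-! ### Non-degeneracy of vertices. -/

lemma exists_smul_eq_of_det_eq_zero {n : ℕ} {w w' : Fin n → ℤ} (hw : w ≠ 0) (hw' : w' ≠ 0)
    (h : ∀ i j, w i * w' j - w j * w' i = 0) : ∃ c : ℝ, c ≠ 0 ∧ intVec w' = c • intVec w := by
  obtain ⟨i, hi⟩ := Function.ne_iff.1 hw
  have hi' : (w i : ℝ) ≠ 0 := by exact_mod_cast hi
  have heq : intVec w' = ((w' i : ℝ) / w i) • intVec w := by
    ext j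
    have := h i j
    have : (w i : ℝ) * w' j - w j * w' i = 0 := by exact_mod_cast this
    simp only [intVec, PiLp.smul_apply, smul_eq_mul]
    field_simp
    linarith
  refine ⟨_, ?_, heq⟩
  intro h0
  rw [h0, zero_smul] at heq
  exact intVec_ne_zero hw' heq

lemma TropicalCurve.exists_isEdgeParam {n : ℕ} {U : Set (EuclideanSpace ℝ (Fin n))}
    (G : TropicalCurve U) (hU : Bornology.IsBounded U) {e : Set (EuclideanSpace ℝ (Fin n))}
    (he : e ∈ G.edges) : ∃ x l, IsEdgeParam U e (G.weight e) x l :=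
  _root_.exists_isEdgeParam hU (G.edge_subset e he) (G.edge_closed e he) (G.edge_convex e he)
    (G.edge_nontrivial e he) (G.weight_ne_zero e he) (G.weight_parallel e he)

lemma mem_edgesAt {n : ℕ} {E : Finset (Set (EuclideanSpace ℝ (Fin n)))}
    {v : EuclideanSpace ℝ (Fin n)} {e : Set (EuclideanSpace ℝ (Fin n))} :
    e ∈ edgesAt E v ↔ e ∈ E ∧ v ∈ edgeEnds e := by
  simp [edgesAt]

/-- The edges at a vertex of a tropical curve do not all lie on one line. -/
lemma TropicalCurve.exists_det_ne_zero {n : ℕ} {U : Set (EuclideanSpace ℝ (Fin n))}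
    (G : TropicalCurve U) (hU : Bornology.IsBounded U) {v : EuclideanSpace ℝ (Fin n)}
    (hv : v ∈ G.vertices) :
    ∃ e ∈ edgesAt G.edges v, ∃ f ∈ edgesAt G.edges v, ∃ i j : Fin n,
      G.weight e i * G.weight f j - G.weight e j * G.weight f i ≠ 0 := by
  by_contra hcon
  push Not at hcon
  obtain ⟨e₀, he₀, hv₀⟩ := hv
  obtain ⟨a, ha, b, hb, c, hc, hab, hac, hbc⟩ := Finset.two_lt_card.1 (G.three_valent e₀ he₀ v hv₀)
  have hout : ∀ e ∈ edgesAt G.edges v, ∃ l,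
      IsEdgeParam U e (outwardRep e (G.weight e) v) v l := by
    intro e he
    obtain ⟨he, hve⟩ := mem_edgesAt.1 he
    obtain ⟨x, l, h⟩ := G.exists_isEdgeParam hU he
    exact ⟨l, h.exists_outward hve⟩
  have hpar : ∀ e ∈ edgesAt G.edges v, ∀ f ∈ edgesAt G.edges v, e ≠ f → ∃ k : ℝ, k < 0 ∧
      intVec (outwardRep f (G.weight f) v) = k • intVec (outwardRep e (G.weight e) v) := by
    intro e he f hf hef
    obtain ⟨l, h⟩ := hout e he
    obtain ⟨l', h'⟩ := hout f hf
    have hor : ∀ g, outwardRep g (G.weight g) v = G.weight g ∨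
        outwardRep g (G.weight g) v = - G.weight g := by
      intro g; unfold outwardRep; split_ifs <;> simp
    obtain ⟨k, hk0, hk⟩ := exists_smul_eq_of_det_eq_zero h.ne_zero h'.ne_zero (by
      intro i j
      have := hcon e he f hf i j
      rcases hor e with h1 | h1 <;> rcases hor f with h2 | h2 <;> rw [h1, h2] <;>
        (try simp only [Pi.neg_apply]) <;> linarith)
    refine ⟨k, lt_of_le_of_ne (not_lt.1 fun hkpos => hef ?_) hk0, hk⟩
    exact h.eq_of_smul_eq h' (G.edge_inter e (mem_edgesAt.1 he).1 f (mem_edgesAt.1 hf).1) hkpos hk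
  -- Only two directions are available for three edges: a and c are both opposite to b, so they
  -- leave v in the same direction.
  obtain ⟨k, hk, h1⟩ := hpar a ha b hb hab
  obtain ⟨k', hk', h2⟩ := hpar b hb c hc hbc
  obtain ⟨l, h⟩ := hout a ha
  obtain ⟨l', h'⟩ := hout c hc
  rw [h1, smul_smul] at h2
  exact hac (h.eq_of_smul_eq h' (G.edge_inter a (mem_edgesAt.1 ha).1 c (mem_edgesAt.1 hc).1)
    (mul_pos_of_neg_of_neg hk' hk) h2)

/-! ### The two simplices. -/

lemma isBounded_simplexU (n : ℕ) (δ : ℝ) : Bornology.IsBounded (simplexU n δ) := by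
  refine Bornology.IsBounded.subset ?_ interior_subset
  rw [isBounded_convexHull]
  exact ((Set.finite_range _).insert _).isBounded

lemma simplexK_subset {n : ℕ} {x : EuclideanSpace ℝ (Fin n)} (hx : x ∈ simplexK n) :
    (∀ i, 0 ≤ x i) ∧ ∑ i, x i ≤ 1 := by
  have hconv : Convex ℝ {x : EuclideanSpace ℝ (Fin n) | (∀ i, 0 ≤ x i) ∧ ∑ i, x i ≤ 1} := by
    intro p hp q hq a b ha hb hab
    refine ⟨fun i => ?_, ?_⟩
    · have h1 := hp.1 i
      have h2 := hq.1 i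
      simp only [PiLp.add_apply, PiLp.smul_apply, smul_eq_mul]
      positivity
    · simp only [PiLp.add_apply, PiLp.smul_apply, smul_eq_mul, Finset.sum_add_distrib,
        ← Finset.mul_sum]
      calc a * ∑ i, p i + b * ∑ i, q i ≤ a * 1 + b * 1 :=
            add_le_add (mul_le_mul_of_nonneg_left hp.2 ha) (mul_le_mul_of_nonneg_left hq.2 hb)
        _ = 1 := by rw [mul_one, mul_one, hab]
  refine convexHull_min ?_ hconv hx
  rintro y (rfl | ⟨i, rfl⟩)
  · simp
  · refine ⟨fun j => ?_, ?_⟩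
    · simp only [PiLp.single_apply]
      split_ifs <;> norm_num
    · simp [PiLp.single_apply]

/-- The barycentric weights are (y i + δ)/T, where T is the extent of the large simplex along each
axis. The remaining weight is nonnegative because ∑ (y i + δ) < 1 + (n + 1)δ ≤ T; this uses n ≤ L.
-/
lemma mem_simplexU {n : ℕ} {δ : ℝ} (hδ : 0 < δ) {x : EuclideanSpace ℝ (Fin n)}
    (h1 : ∀ i, -δ < x i) (h2 : ∑ i, x i < 1 + δ) : x ∈ simplexU n δ := by
  set O : Set (EuclideanSpace ℝ (Fin n)) := {x | (∀ i, -δ < x i) ∧ ∑ i, x i < 1 + δ} with hO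
  have hopen : IsOpen O := by
    have hO' : O = (⋂ i, {x : EuclideanSpace ℝ (Fin n) | -δ < x i}) ∩
        {x : EuclideanSpace ℝ (Fin n) | ∑ i, x i < 1 + δ} := by
      ext x; simp [hO]
    rw [hO']
    exact (isOpen_iInter_of_finite fun i => isOpen_lt continuous_const (by fun_prop)).inter
      (isOpen_lt (by fun_prop) continuous_const)
  refine interior_maximal ?_ hopen (show x ∈ O from ⟨h1, h2⟩)
  intro y hy
  set L : ℝ := ((max 3 n : ℕ) : ℝ) with hL
  have hLn : (n : ℝ) ≤ L := Nat.cast_le.2 (le_max_right 3 n)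
  have hn0 : (0 : ℝ) ≤ n := Nat.cast_nonneg n
  set T : ℝ := 1 + (L + 1) * δ with hT
  have hTpos : 0 < T := by positivity
  set P : Option (Fin n) → EuclideanSpace ℝ (Fin n) := fun o => o.elim
    (WithLp.toLp 2 (fun _ : Fin n => -δ))
    (fun i => WithLp.toLp 2 (fun j : Fin n => if j = i then 1 + L * δ else -δ)) with hP
  set lam : Option (Fin n) → ℝ := fun o => o.elim
    (1 - ∑ i, (y i + δ) / T) (fun i => (y i + δ) / T) with hlam
  have hsum : ∑ i, (y i + δ) / T = (∑ i, y i + n * δ) / T := by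
    rw [← Finset.sum_div, Finset.sum_add_distrib]; simp
  have hmem : ∑ o, lam o • P o ∈ convexHull ℝ (Set.range P) := by
    refine (convex_convexHull ℝ _).sum_mem ?_ ?_ fun o _ => subset_convexHull ℝ _ ⟨o, rfl⟩
    · rintro (_ | i) _
      · simp only [hlam, Option.elim_none, hsum, sub_nonneg]
        rw [div_le_one hTpos, hT]
        nlinarith [hy.2, mul_le_mul_of_nonneg_right hLn hδ.le]
      · simp only [hlam, Option.elim_some]
        exact div_nonneg (by linarith [hy.1 i]) hTpos.le
    · simp [Fintype.sum_option, hlam]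
  have hyeq : ∑ o, lam o • P o = y := by
    ext j
    have hj : ∀ i, (y i + δ) / T * (if j = i then 1 + L * δ else -δ) =
        (if j = i then y i + δ else 0) - δ * ((y i + δ) / T) := by
      intro i
      split_ifs
      · field_simp
        rw [hT]; ring
      · ring
    simp only [Fintype.sum_option, hlam, hP, Option.elim_none, Option.elim_some, PiLp.add_apply,
      PiLp.smul_apply, WithLp.ofLp_sum, Finset.sum_apply, smul_eq_mul, WithLp.ofLp_smul,
      Pi.smul_apply, hj, Finset.sum_sub_distrib, ← Finset.mul_sum]
    simp
    ring
  rw [hyeq] at hmem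
  refine convexHull_mono ?_ hmem
  rintro _ ⟨o, rfl⟩
  cases o with
  | none => exact Set.mem_insert _ _
  | some i => exact Set.mem_insert_of_mem _ ⟨i, rfl⟩

lemma sum_sub_le_sqrt_mul_dist {n : ℕ} (x y : EuclideanSpace ℝ (Fin n)) :
    ∑ i, x i - ∑ i, y i ≤ √n * dist x y := by
  rw [dist_eq_norm, ← Finset.sum_sub_distrib, EuclideanSpace.norm_eq, ← Real.sqrt_mul (by simp)]
  apply Real.le_sqrt_of_sq_le
  have := sq_sum_le_card_mul_sum_sq (s := Finset.univ) (f := fun i => x i - y i)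
  simpa using this

/-- A move by d lowers each coordinate by at most d and, by Cauchy–Schwarz, raises the coordinate
sum by at most √n d. This is the origin of the radius δ/√n. -/
lemma mem_simplexU_of_infDist_lt {n : ℕ} (hn : 1 ≤ n) {δ : ℝ} (hδ : 0 < δ)
    {x : EuclideanSpace ℝ (Fin n)} (h : Metric.infDist x (simplexK n) < δ / √n) :
    x ∈ simplexU n δ := by
  have hne : (simplexK n).Nonempty := ⟨0, subset_convexHull ℝ _ (Set.mem_insert _ _)⟩
  obtain ⟨y, hy, hxy⟩ := (Metric.infDist_lt_iff hne).1 h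
  obtain ⟨hy1, hy2⟩ := simplexK_subset hy
  have hn1 : (1 : ℝ) ≤ √n := Real.one_le_sqrt.2 (by exact_mod_cast hn)
  have hxy' : √n * dist x y < δ := by
    rw [lt_div_iff₀ (by linarith)] at hxy
    linarith
  apply mem_simplexU hδ
  · intro i
    have h1 : |x i - y i| ≤ dist x y := by
      rw [dist_eq_norm]
      exact PiLp.norm_apply_le (x - y) i
    have h2 := neg_le_of_abs_le h1
    have h3 : dist x y ≤ √n * dist x y := le_mul_of_one_le_left dist_nonneg hn1
    linarith [hy1 i]
  · linarith [sum_sub_le_sqrt_mul_dist x y]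

/-! ### Choice of a level by averaging. -/

open Classical in
/-- Among the levels `t` in `(0, r)` there is one at which the weighted number of intervals with
ends `p`, `q` that contain `t` is at most its average. -/
lemma exists_level_sum_le {I : Type*} [Fintype I] {ω p q : I → ℝ} (hω : ∀ i, 0 ≤ ω i) {A r : ℝ}
    (hr : 0 < r) (hA : ∑ i, ω i * |p i - q i| ≤ A) :
    ∃ t ∈ Set.Ioo 0 r, ∑ i, (if min (p i) (q i) < t ∧ t ≤ max (p i) (q i) then ω i else 0) ≤
      A / r := by
  -- Half-open intervals: t is counted exactly when one end value is less than t and the other is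
  -- not.
  set F : I → ℝ → ℝ := fun i => (Set.Ioc (min (p i) (q i)) (max (p i) (q i))).indicator
    fun _ => ω i with hF
  have hint : ∀ i, MeasureTheory.Integrable (F i) := by
    intro i
    rw [hF, MeasureTheory.integrable_indicator_iff measurableSet_Ioc]
    exact MeasureTheory.integrableOn_const (by simp)
  have hFle : ∀ i, ∫ t in Set.Ioo 0 r, F i t ≤ ω i * |p i - q i| := by
    intro i
    calc ∫ t in Set.Ioo 0 r, F i t ≤ ∫ t, F i t :=
          MeasureTheory.setIntegral_le_integral (hint i)
            (Filter.Eventually.of_forall fun t => Set.indicator_nonneg (fun _ _ => hω i) t)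
      _ = ω i * |p i - q i| := by
          rw [hF, MeasureTheory.integral_indicator measurableSet_Ioc,
            MeasureTheory.setIntegral_const, smul_eq_mul, mul_comm]
          simp [MeasureTheory.measureReal_def, max_sub_min_eq_abs']
  obtain ⟨t, ht, hle⟩ := MeasureTheory.exists_le_setAverage (μ := MeasureTheory.volume)
    (s := Set.Ioo 0 r) (f := fun t => ∑ i, F i t) (by simp [hr]) (by simp)
    (MeasureTheory.integrable_finsetSum _ fun i _ => hint i).integrableOn
  refine ⟨t, ht, ?_⟩
  calc ∑ i, (if min (p i) (q i) < t ∧ t ≤ max (p i) (q i) then ω i else 0) = ∑ i, F i t := by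
        refine Finset.sum_congr rfl fun i _ => ?_
        simp only [hF, Set.indicator_apply, Set.mem_Ioc]
    _ ≤ _ := hle
    _ ≤ A / r := by
        rw [MeasureTheory.setAverage_eq, MeasureTheory.integral_finsetSum _ fun i _ =>
          (hint i).integrableOn]
        simp only [MeasureTheory.measureReal_def, Real.volume_Ioo, sub_zero,
          ENNReal.toReal_ofReal hr.le, smul_eq_mul]
        rw [div_eq_inv_mul]
        exact mul_le_mul_of_nonneg_left
          ((Finset.sum_le_sum fun i _ => hFle i).trans hA) (inv_nonneg.2 hr.le)

/-! ### Projection of the curve to a coordinate plane. -/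

/-- The projection of an integral vector to the coordinate plane of the indices `i`, `j`. -/
def planeProj {n : ℕ} (i j : Fin n) (w : Fin n → ℤ) : ℝ × ℝ := (w i, w j)

lemma planeDet_planeProj {n : ℕ} (i j : Fin n) (w w' : Fin n → ℤ) :
    planeDet (planeProj i j w) (planeProj i j w') = ((w i * w' j - w j * w' i : ℤ) : ℝ) := by
  simp [planeDet, planeProj]

lemma planeProj_neg {n : ℕ} (i j : Fin n) (w : Fin n → ℤ) :
    planeProj i j (-w) = - planeProj i j w := by
  simp [planeProj]

/-- By Lagrange's identity, the squared determinant plus the squared inner product is the product of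
the squared norms of the projections, and projecting does not increase norms. -/
lemma abs_planeDet_planeProj_le {n : ℕ} {i j : Fin n} (hij : i ≠ j) (w w' : Fin n → ℤ) :
    |planeDet (planeProj i j w) (planeProj i j w')| ≤ ‖intVec w‖ * ‖intVec w'‖ := by
  have hsq : ∀ w : Fin n → ℤ, (w i : ℝ) ^ 2 + (w j : ℝ) ^ 2 ≤ ‖intVec w‖ ^ 2 := by
    intro w
    rw [EuclideanSpace.norm_sq_eq, ← Finset.sum_pair hij (f := fun k => (w k : ℝ) ^ 2)]
    simp only [intVec, Real.norm_eq_abs, sq_abs]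
    exact Finset.sum_le_sum_of_subset_of_nonneg (Finset.subset_univ _) fun _ _ _ => sq_nonneg _
  apply abs_le_of_sq_le_sq _ (by positivity)
  have h1 := mul_le_mul (hsq w) (hsq w') (by positivity) (by positivity)
  simp only [planeDet, planeProj]
  nlinarith [sq_nonneg ((w i : ℝ) * w' i + w j * w' j)]

/-- Half-edges point from the middle of e to its ends, hence the minus sign. As v lies in U, an end
equal to v does belong to e; at most one end equals v. -/
lemma IsEdgeParam.sum_ends {n : ℕ} {U e : Set (EuclideanSpace ℝ (Fin n))} {w : Fin n → ℤ}
    {x v : EuclideanSpace ℝ (Fin n)} {l : ℝ} (h : IsEdgeParam U e w x l) (hv : v ∈ U)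
    [Decidable (x + l • intVec w = v)] [Decidable (x = v)] [Decidable (v ∈ edgeEnds e)]
    (i j : Fin n) :
    (if x + l • intVec w = v then planeProj i j w else 0) +
      (if x = v then - planeProj i j w else 0) =
    if v ∈ edgeEnds e then - planeProj i j (outwardRep e w v) else 0 := by
  by_cases h1 : x = v
  · have h2 : x + l • intVec w ≠ v := by rw [← h1]; exact h.left_ne_right.symm
    have h3 : v ∈ edgeEnds e := h.mem_edgeEnds_iff.2 ⟨by rw [← h1] at hv ⊢; exact h.left_mem hv,
      Or.inl h1.symm⟩
    rw [if_neg h2, if_pos h1, if_pos h3, ← h1, h.outwardRep_left, zero_add]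
  · by_cases h2 : x + l • intVec w = v
    · have h3 : v ∈ edgeEnds e := h.mem_edgeEnds_iff.2
        ⟨by rw [← h2] at hv ⊢; exact h.right_mem hv, Or.inr h2.symm⟩
      rw [if_pos h2, if_neg h1, if_pos h3, ← h2, h.outwardRep_right, add_zero, planeProj_neg,
        neg_neg]
    · have h3 : v ∉ edgeEnds e := fun h3 => by
        rcases (h.mem_edgeEnds_iff.1 h3).2 with h4 | h4
        · exact h1 h4.symm
        · exact h2 h4.symm
      rw [if_neg h2, if_neg h1, if_neg h3, add_zero]

lemma TropicalCurve.sum_outwardRep_eq_zero {n : ℕ} {U : Set (EuclideanSpace ℝ (Fin n))}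
    (G : TropicalCurve U) (v : EuclideanSpace ℝ (Fin n)) (i j : Fin n) :
    ∑ e ∈ edgesAt G.edges v, planeProj i j (outwardRep e (G.weight e) v) = 0 := by
  rcases (edgesAt G.edges v).eq_empty_or_nonempty with h | ⟨e, he⟩
  · simp [h]
  · obtain ⟨he, hv⟩ := mem_edgesAt.1 he
    have hb := G.balanced e he v hv
    have hk : ∀ k, ∑ f ∈ edgesAt G.edges v, ((outwardRep f (G.weight f) v k : ℤ) : ℝ) = 0 := by
      intro k
      have := congrFun hb k
      rw [Finset.sum_apply] at this
      exact_mod_cast this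
    refine Prod.ext ?_ ?_
    · simpa [Prod.fst_sum, planeProj] using hk i
    · simpa [Prod.snd_sum, planeProj] using hk j

open Classical in
/-- The number of vertices in `{g < t}` that are not degenerate in the `i, j` coordinate plane, in
terms of the weights of the edges that leave `{g < t}`. -/
lemma TropicalCurve.card_le_sq {n : ℕ} {U : Set (EuclideanSpace ℝ (Fin n))}
    (G : TropicalCurve U) {x : Set (EuclideanSpace ℝ (Fin n)) → EuclideanSpace ℝ (Fin n)}
    {l : Set (EuclideanSpace ℝ (Fin n)) → ℝ}
    (hp : ∀ e ∈ G.edges, IsEdgeParam U e (G.weight e) (x e) (l e))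
    {g : EuclideanSpace ℝ (Fin n) → ℝ} {t : ℝ} (hg : ∀ v, g v < t → v ∈ U) {i j : Fin n}
    (hij : i ≠ j) {W : Finset (EuclideanSpace ℝ (Fin n))} (hWg : ∀ v ∈ W, g v < t)
    (hW : ∀ v ∈ W, ∃ e ∈ edgesAt G.edges v, ∃ f ∈ edgesAt G.edges v,
      G.weight e i * G.weight f j - G.weight e j * G.weight f i ≠ 0) :
    (W.card : ℝ) ≤ (∑ e ∈ G.edges,
      if min (g (x e)) (g (x e + l e • intVec (G.weight e))) < t ∧
        t ≤ max (g (x e)) (g (x e + l e • intVec (G.weight e))) then ‖intVec (G.weight e)‖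
      else 0) ^ 2 := by
  set y : Set (EuclideanSpace ℝ (Fin n)) → EuclideanSpace ℝ (Fin n) :=
    fun e => x e + l e • intVec (G.weight e) with hy
  -- An edge with no end in {g < t} is dropped even if it passes through this set: it does not enter
  -- the balance at any vertex there.
  set F := G.edges.filter fun e => g (x e) < t ∨ g (y e) < t with hF
  have hFG : ∀ e : F, e.1 ∈ G.edges := fun e => (Finset.mem_filter.1 e.2).1
  set pr : EuclideanSpace ℝ (Fin n) → ℝ × ℝ := fun v => (v i, v j) with hpr
  set p : Set (EuclideanSpace ℝ (Fin n)) → ℝ × ℝ := fun e => planeProj i j (G.weight e) with hpdef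
  set z : F × Bool → EuclideanSpace ℝ (Fin n) := fun h => if h.2 then y h.1 else x h.1 with hz
  set u : F × Bool → ℝ × ℝ := fun h => if h.2 then p h.1 else - p h.1 with hu
  -- Edges are cut at their midpoints, where the two halves have opposite directions and balance.
  set a : F × Bool → ℝ × ℝ := fun h => pr (x h.1) + (l h.1 / 2) • p h.1 with ha
  set C : F × Bool → Prop := fun h => g (z h) < t with hC
  have hdet : ∀ h h', |planeDet (u h) (u h')| = |planeDet (p h.1) (p h'.1)| := by
    rintro ⟨e, b⟩ ⟨e', b'⟩
    cases b <;> cases b' <;> simp [hu, planeDet_neg_left, planeDet_neg_right]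
  have hmemz : ∀ v, g v < t → ∀ e ∈ edgesAt G.edges v, ∃ h : F × Bool, C h ∧ z h = v ∧
      h.1.1 = e := by
    intro v hv e he
    obtain ⟨he, hve⟩ := mem_edgesAt.1 he
    rcases ((hp e he).mem_edgeEnds_iff.1 hve).2 with h | h
    · exact ⟨(⟨e, Finset.mem_filter.2 ⟨he, Or.inl (h ▸ hv)⟩⟩, false), by
        simpa [hC, hz, ← h] using hv, by simp [hz, h], rfl⟩
    · exact ⟨(⟨e, Finset.mem_filter.2 ⟨he, Or.inr ((show v = y e from h) ▸ hv)⟩⟩, true), by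
        simpa [hC, hz, hy, ← h] using hv, by simp [hz, hy, h], rfl⟩
  have hlocal : ∀ v, ∑ h with C h ∧ z h = v, u h = 0 := by
    intro v
    by_cases hv : g v < t
    · have h1 : ∑ h with C h ∧ z h = v, u h =
          ∑ e : F, ((if y e = v then p e else 0) + (if x e = v then - p e else 0)) := by
        rw [Finset.sum_filter, Fintype.sum_prod_type]
        refine Finset.sum_congr rfl fun e _ => ?_
        have hiff : ∀ q, (g q < t ∧ q = v) ↔ q = v := fun q =>
          ⟨fun h => h.2, fun h => ⟨h ▸ hv, h⟩⟩
        simp [hC, hz, hu, hiff]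
      rw [h1, Finset.sum_coe_sort F
        (fun e => (if y e = v then p e else 0) + (if x e = v then - p e else 0))]
      calc _ = ∑ e ∈ F, if v ∈ edgeEnds e then - planeProj i j (outwardRep e (G.weight e) v)
              else 0 := Finset.sum_congr rfl fun e he =>
            (hp e (Finset.mem_filter.1 he).1).sum_ends (hg v hv) i j
        _ = ∑ e ∈ G.edges, if v ∈ edgeEnds e then - planeProj i j (outwardRep e (G.weight e) v)
              else 0 := by
            refine Finset.sum_subset (Finset.filter_subset _ _) fun e he heF => if_neg fun hve => ?_
            obtain ⟨h, -, -, hhe⟩ := hmemz v hv e (mem_edgesAt.2 ⟨he, hve⟩)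
            exact heF (hhe ▸ h.1.2)
        _ = - ∑ e ∈ edgesAt G.edges v, planeProj i j (outwardRep e (G.weight e) v) := by
            rw [← Finset.sum_filter, Finset.sum_neg_distrib]; rfl
        _ = 0 := by rw [G.sum_outwardRep_eq_zero, neg_zero]
    · refine Finset.sum_eq_zero fun h hh => absurd ?_ hv
      simp only [Finset.mem_filter, Finset.mem_univ, true_and] at hh
      exact hh.2 ▸ hh.1
  have hcount := card_le_sum_planeDet (a := a) (u := u) (s := fun h => l h.1 / 2) (C := C) (z := z)
    (q := pr) (W := W) (fun h => half_pos (hp _ (hFG h.1)).pos) ?_ ?_ ?_ ?_ ?_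
  · refine hcount.trans ?_
    have hS : ∑ h with ¬ C h, ‖intVec (G.weight h.1)‖ ≤ ∑ e ∈ G.edges,
        if min (g (x e)) (g (y e)) < t ∧ t ≤ max (g (x e)) (g (y e)) then ‖intVec (G.weight e)‖
        else 0 := by
      rw [Finset.sum_filter, Fintype.sum_prod_type]
      simp only [Fintype.sum_bool, hC, hz, if_true, Bool.false_eq_true, if_false]
      rw [Finset.sum_coe_sort F (fun e => (if ¬ g (y e) < t then ‖intVec (G.weight e)‖ else 0) +
        (if ¬ g (x e) < t then ‖intVec (G.weight e)‖ else 0))]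
      refine (Finset.sum_le_sum fun e he => ?_).trans
        (Finset.sum_le_sum_of_subset_of_nonneg (Finset.filter_subset _ _) fun e _ _ => ?_)
      · have hor := (Finset.mem_filter.1 he).2
        simp only [min_lt_iff, hor, true_and, ← not_lt]
        by_cases h1 : g (x e) < t <;> by_cases h2 : g (y e) < t
        · simp [h1, h2]
        · simp [h1, h2]
        · simp [h1, h2]
        · exact absurd hor (by simp [h1, h2])
      · split_ifs
        · exact norm_nonneg _
        · exact le_rfl
    calc ∑ h with ¬ C h, ∑ h' with ¬ C h', |planeDet (u h) (u h')|
        ≤ ∑ h with ¬ C h, ∑ h' with ¬ C h',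
            ‖intVec (G.weight h.1)‖ * ‖intVec (G.weight h'.1)‖ :=
          Finset.sum_le_sum fun h _ => Finset.sum_le_sum fun h' _ => by
            rw [hdet]
            exact abs_planeDet_planeProj_le hij _ _
      _ = (∑ h with ¬ C h, ‖intVec (G.weight h.1)‖) ^ 2 := by
          rw [sq, Finset.sum_mul_sum]
      _ ≤ _ := pow_le_pow_left₀ (Finset.sum_nonneg fun _ _ => norm_nonneg _) hS 2
  · rintro ⟨e, b⟩ -
    have hpy : pr (y e) = pr (x e) + l e • p e := by
      simp [hpr, hy, hpdef, planeProj, intVec]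
    cases b
    · simp only [hz, ha, hu, Bool.false_eq_true, if_false]
      module
    · simp only [hz, ha, hu, if_true, hpy]
      module
  · intro ψ
    rw [Fintype.sum_prod_type]
    exact Finset.sum_eq_zero fun e _ => by simp [hu, ha]
  · intro ψ
    rw [← Finset.sum_fiberwise_of_maps_to (t := Finset.univ.image z) (g := z)
      fun h _ => Finset.mem_image_of_mem z (Finset.mem_univ h)]
    refine Finset.sum_eq_zero fun v _ => ?_
    rw [Finset.filter_filter]
    calc _ = ∑ h with C h ∧ z h = v, ψ v • u h := Finset.sum_congr rfl fun h hh => by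
          rw [(Finset.mem_filter.1 hh).2.2]
      _ = 0 := by rw [← Finset.smul_sum, hlocal, smul_zero]
  · intro h h' hne
    have hne' := abs_ne_zero.2 hne
    rw [hdet, abs_ne_zero, hpdef, planeDet_planeProj] at hne'
    rw [hdet, hpdef, planeDet_planeProj]
    exact_mod_cast Int.one_le_abs (by exact_mod_cast hne')
  · intro v hv
    obtain ⟨e, he, f, hf, hef⟩ := hW v hv
    obtain ⟨h, hCh, hzh, hhe⟩ := hmemz v (hWg v hv) e he
    obtain ⟨h', hCh', hzh', hhf⟩ := hmemz v (hWg v hv) f hf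
    refine ⟨h, h', hCh, hCh', hzh, hzh', ?_⟩
    rw [← abs_ne_zero, hdet, abs_ne_zero, hpdef, planeDet_planeProj, hhe, hhf]
    exact_mod_cast hef

lemma TropicalCurve.finite_vertices {n : ℕ} {U : Set (EuclideanSpace ℝ (Fin n))}
    (G : TropicalCurve U) (hU : Bornology.IsBounded U) : G.vertices.Finite := by
  have : G.vertices = ⋃ e ∈ G.edges, edgeEnds e := by
    ext v; simp [TropicalCurve.vertices]
  rw [this]
  refine G.edges.finite_toSet.biUnion fun e he => ?_
  obtain ⟨x, l, h⟩ := G.exists_isEdgeParam hU he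
  exact (Set.toFinite {x, x + l • intVec (G.weight e)}).subset fun v hv =>
    (h.mem_edgeEnds_iff.1 hv).2

/-! ### The bound on the number of vertices. -/

theorem mainTheorem2 (n : ℕ) (hn : 2 ≤ n) (A δ : ℝ) (hA : 0 < A) (hδ : 0 < δ) :
    ∃ N : ℕ,
      (N : ℝ) ≤ 2 * ((n : ℝ) - 1) ^ 2 * (A + (n : ℝ) * (A / δ) ^ 2) ^ 2 ∧
      ∀ G : TropicalCurve (simplexU n δ), G.area ≤ ENNReal.ofReal A →
        (G.vertices ∩ interior (simplexK n)).Finite ∧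
        (G.vertices ∩ interior (simplexK n)).ncard ≤ N := by
  classical
  refine ⟨⌊2 * ((n : ℝ) - 1) ^ 2 * (A + (n : ℝ) * (A / δ) ^ 2) ^ 2⌋₊,
    Nat.floor_le (by positivity), fun G hG => ?_⟩
  have hU := isBounded_simplexU n δ
  have hfin := (G.finite_vertices hU).inter_of_left (interior (simplexK n))
  refine ⟨hfin, Nat.le_floor ?_⟩
  have hn2 : (2 : ℝ) ≤ n := by exact_mod_cast hn
  have hsqrt : 0 < √(n : ℝ) := Real.sqrt_pos.2 (by linarith)
  have hparam : ∀ e, e ∈ G.edges → ∃ x l, IsEdgeParam (simplexU n δ) e (G.weight e) x l :=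
    fun e he => G.exists_isEdgeParam hU he
  choose! x l hp using hparam
  set g : EuclideanSpace ℝ (Fin n) → ℝ := fun v => Metric.infDist v (simplexK n) with hg
  set y : Set (EuclideanSpace ℝ (Fin n)) → EuclideanSpace ℝ (Fin n) :=
    fun e => x e + l e • intVec (G.weight e) with hy
  set ω : Set (EuclideanSpace ℝ (Fin n)) → ℝ := fun e => ‖intVec (G.weight e)‖ with hω
  have harea : ∑ e ∈ G.edges, ω e * |g (x e) - g (y e)| ≤ A := by
    -- The norm of the weight occurs twice, since the length of e is l e times that norm.
    have h1 : ∑ e ∈ G.edges, (l e * ω e) * ω e ≤ A := by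
      rw [← ENNReal.ofReal_le_ofReal_iff hA.le, ENNReal.ofReal_sum_of_nonneg fun e he =>
        mul_nonneg (mul_nonneg (hp e he).pos.le (norm_nonneg _)) (norm_nonneg _)]
      refine le_trans (Finset.sum_le_sum fun e he => ?_) hG
      rw [ENNReal.ofReal_mul (mul_nonneg (hp e he).pos.le (norm_nonneg _))]
      exact mul_le_mul_left (hp e he).le_ediam _
    refine (Finset.sum_le_sum fun e he => ?_).trans h1
    rw [mul_comm (l e * ω e)]
    refine mul_le_mul_of_nonneg_left ?_ (norm_nonneg _)
    have := (Metric.lipschitz_infDist_pt (simplexK n)).dist_le_mul (x e) (y e)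
    rw [Real.dist_eq, dist_eq_norm] at this
    simpa [hy, norm_smul, abs_of_pos (hp e he).pos] using this
  obtain ⟨t, ht, hle⟩ := exists_level_sum_le (I := G.edges) (ω := fun e => ω e)
    (p := fun e => g (x e)) (q := fun e => g (y e)) (A := A) (r := δ / √n)
    (fun e => norm_nonneg _) (by positivity) (by
      rwa [Finset.sum_coe_sort G.edges fun e => ω e * |g (x e) - g (y e)|])
  rw [Finset.sum_coe_sort G.edges fun e => if min (g (x e)) (g (y e)) < t ∧
    t ≤ max (g (x e)) (g (y e)) then ω e else 0] at hle
  set S := ∑ e ∈ G.edges, if min (g (x e)) (g (y e)) < t ∧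
    t ≤ max (g (x e)) (g (y e)) then ω e else 0 with hS
  -- Integral nonzero weights have norm at least 1. The dichotomy serves to get 1 ≤ Q below, so that
  -- Q ≤ (A + Q)².
  have hS01 : S = 0 ∨ 1 ≤ S := by
    have hnn : ∀ e ∈ G.edges, 0 ≤ if min (g (x e)) (g (y e)) < t ∧
        t ≤ max (g (x e)) (g (y e)) then ω e else 0 := fun e _ => by
      split_ifs
      · exact norm_nonneg _
      · exact le_rfl
    by_cases h : ∃ e ∈ G.edges, min (g (x e)) (g (y e)) < t ∧ t ≤ max (g (x e)) (g (y e))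
    · obtain ⟨e, he, hlt⟩ := h
      right
      calc 1 ≤ ω e := one_le_norm_intVec (G.weight_ne_zero e he)
        _ = if min (g (x e)) (g (y e)) < t ∧ t ≤ max (g (x e)) (g (y e)) then ω e else 0 :=
          (if_pos hlt).symm
        _ ≤ S := Finset.single_le_sum hnn he
    · push Not at h
      left
      exact Finset.sum_eq_zero fun e he => if_neg fun hh => absurd hh.2 (not_le.2 (h e he hh.1))
  have hgU : ∀ v, g v < t → v ∈ simplexU n δ := fun v hv =>
    mem_simplexU_of_infDist_lt (by omega) hδ (hv.trans ht.2)
  set V := hfin.toFinset with hV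
  have hVg : ∀ v ∈ V, g v < t := by
    intro v hv
    have : g v = 0 := Metric.infDist_zero_of_mem (interior_subset (hfin.mem_toFinset.1 hv).2)
    rw [this]
    exact ht.1
  set W : Fin n × Fin n → Finset (EuclideanSpace ℝ (Fin n)) := fun k => V.filter fun v =>
    ∃ e ∈ edgesAt G.edges v, ∃ f ∈ edgesAt G.edges v,
      G.weight e k.1 * G.weight f k.2 - G.weight e k.2 * G.weight f k.1 ≠ 0 with hW
  have hVW : V ⊆ (Finset.univ : Finset (Fin n)).offDiag.biUnion W := by
    intro v hv
    obtain ⟨e, he, f, hf, i, j, hne⟩ :=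
      G.exists_det_ne_zero hU (hfin.mem_toFinset.1 hv).1
    refine Finset.mem_biUnion.2 ⟨(i, j), ?_, Finset.mem_filter.2 ⟨hv, e, he, f, hf, hne⟩⟩
    simp only [Finset.mem_offDiag, Finset.mem_univ, true_and]
    rintro rfl
    exact hne (by ring)
  have hcard : (V.card : ℝ) ≤ (n * (n - 1)) * S ^ 2 := by
    calc (V.card : ℝ) ≤ ∑ k ∈ (Finset.univ : Finset (Fin n)).offDiag, ((W k).card : ℝ) := by
          exact_mod_cast (Finset.card_le_card hVW).trans Finset.card_biUnion_le
      _ ≤ ∑ k ∈ (Finset.univ : Finset (Fin n)).offDiag, S ^ 2 := by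
          refine Finset.sum_le_sum fun k hk => ?_
          refine G.card_le_sq hp hgU (Finset.mem_offDiag.1 hk).2.2 (fun v hv => ?_) fun v hv => ?_
          · exact hVg v (Finset.mem_filter.1 hv).1
          · exact (Finset.mem_filter.1 hv).2
      _ = (n * (n - 1)) * S ^ 2 := by
          rw [Finset.sum_const, Finset.offDiag_card, nsmul_eq_mul, Finset.card_univ,
            Fintype.card_fin, Nat.cast_sub (Nat.le_mul_self n)]
          push_cast
          ring
  rw [Set.ncard_eq_toFinset_card _ hfin]
  refine hcard.trans ?_
  rcases hS01 with h0 | h1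
  · rw [h0]
    simp only [ne_eq, OfNat.ofNat_ne_zero, not_false_eq_true, zero_pow, mul_zero]
    positivity
  · set Q := (n : ℝ) * (A / δ) ^ 2 with hQ
    have hSQ : S ^ 2 ≤ Q := by
      have h2 : S ≤ √n * (A / δ) := by
        refine hle.trans (le_of_eq ?_)
        field_simp
      calc S ^ 2 ≤ (√n * (A / δ)) ^ 2 := pow_le_pow_left₀ (by linarith) h2 2
        _ = Q := by rw [mul_pow, Real.sq_sqrt (by linarith)]
    have hQ1 : 1 ≤ Q := by nlinarith
    -- The count already gives n(n-1)Q; the rest only weakens it, using n ≤ 2(n-1) for n ≥ 2.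
    calc (n * (n - 1)) * S ^ 2 ≤ (n * (n - 1)) * Q :=
          mul_le_mul_of_nonneg_left hSQ (mul_nonneg (by linarith) (by linarith))
      _ ≤ (2 * (n - 1) ^ 2) * Q := by
          refine mul_le_mul_of_nonneg_right ?_ (by linarith)
          nlinarith
      _ ≤ (2 * (n - 1) ^ 2) * (A + Q) ^ 2 := by
          refine mul_le_mul_of_nonneg_left ?_ (by positivity)
          nlinarith
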